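/- **Proposition (Holonomy of $\mathrm{Sym}(2,\mathbb R)$).** Let $\mathrm{Sym}(2,\mathbb R)$ be the space of real symmetric $2\times2$ matrices with the global chart $\begin{pmatrix}x+z&y\\y&-x+z\end{pmatrix}\mapsto(x,y,z)$, let $L=\{x=y=0\}$ be the line of scalar matrices, and let $(r,\phi,z)$ be the cylindrical coordinates of $(x,y,z)$. Away from $L$ consider the Riemannian metric $$g=\begin{pmatrix}1+3x^2/r^2&3xy/r^2&0\\3xy/r^2&1+3y^2/r^2&0\\0&0&1\end{pmatrix}$$ with its Levi-Civita connection $\nabla$, and the $g$-orthonormal frame $e_1=\cos\phi\,\frac{\partial_r}{2}-\sin\phi\,\frac{\partial_\phi}{r}$, $e_2=\sin\phi\,\frac{\partial_r}{2}+\cos\phi\,\frac{\partial_\phi}{r}$, $e_3=\partial_z$. Fix a base point $p\in \mathrm{Sym}(2,\mathbb R)\setminus L$. A *loop* at $p$ is a piecewise smooth closed curve $\gamma:[0,1]\to\mathrm{Sym}(2,\mathbb R)$ with $\gamma(0)=\gamma(1)=p$ which may cross $L$, but only at times where it is smooth and its velocity is not tangent to $L$. Its winding number around $L$ is $W(\gamma;L)=\frac1{2\pi}\int_\gamma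 d\phi$. A vector field $E$ along $\gamma$ is *parallel* if, away from $L$, it is continuous and satisfies $\nabla_{\gamma'}E=0$ wherever $\gamma$ is differentiable, and if, at each crossing of $L$, its components in the frame $(e_1,e_2,e_3)$ extend continuously. For $U=\mathrm{Sym}(2,\mathbb R)\setminus L$ or $U=\mathrm{Sym}(2,\mathbb R)$, the holonomy group $\mathrm{Hol}_p(U)$ is the group generated by the parallel transports $T_p\to T_p$ along the loops at $p$ that stay in $U$. Let $R_p(\theta)$ be the rotation of the tangent space $T_p$ by the angle $\theta$ in the plane of $e_1,e_2$ (from $e_1$ towards $e_2$) that fixes $e_3$. Then: 0. For every loop $\gamma$ at $p$, the integral defining $W(\gamma;L)$ converges absolutely, and the parallel transport along $\gamma$ exists, is unique, and equals $R_p(\pi\, W(\gamma;L))$. 1. $\mathrm{Hol}_p(\mathrm{Sym}(2,\mathbb R)\setminus L)=\{R_p(k\pi):k\in\mathbb Z\}\cong\mathbb Z_2$. 2. $\mathrm{Hol}_p(\mathrm{Sym}(2,\mathbb R))=\{R_p(k\pi/2):k\in\mathbb Z\}\cong\mathbb Z_4$. In both cases every element of the holonomy group is the parallel transport along a single loop at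 $p$ in $U$. -/

import Mathlib

open scoped ContDiff Topology

noncomputable section

namespace SymHol

/-- The space `Sym(2,ℝ)` of real symmetric 2-by-2 matrices. -/
abbrev SymMat : Type := {A : Matrix (Fin 2) (Fin 2) ℝ // A.IsSymm}

/-- Coordinate vectors; also the tangent spaces, in the basis `∂_x, ∂_y, ∂_z` of the chart. -/
abbrev V : Type := Fin 3 → ℝ

/-- The global cartesian chart `!![x + z, y; y, -x + z] ↦ (x, y, z)`. -/
def chart : SymMat ≃ V where
  toFun A := ![(A.1 0 0 - A.1 1 1) / 2, A.1 0 1, (A.1 0 0 + A.1 1 1) / 2]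
  invFun q := ⟨!![q 0 + q 2, q 1; q 1, -q 0 + q 2], by
    ext i j; fin_cases i <;> fin_cases j <;> simp⟩
  left_inv A := by
    have h : A.1 1 0 = A.1 0 1 := A.2.apply 0 1
    ext i j
    fin_cases i <;> fin_cases j <;> simp [h] <;> ring
  right_inv q := by
    ext i
    fin_cases i <;> simp <;> ring

/-- The singular line `L` of scalar matrices. -/
def L : Set SymMat := {A | ∃ c : ℝ, A.1 = c • (1 : Matrix (Fin 2) (Fin 2) ℝ)}

/-- `r² = x² + y²`. -/
def rSq (q : V) : ℝ := q 0 ^ 2 + q 1 ^ 2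

/-- The metric tensor in the chart; it is smooth away from `L`. -/
def metric (q : V) : Matrix (Fin 3) (Fin 3) ℝ :=
  !![1 + 3 * q 0 ^ 2 / rSq q, 3 * q 0 * q 1 / rSq q, 0;
     3 * q 0 * q 1 / rSq q, 1 + 3 * q 1 ^ 2 / rSq q, 0;
     0, 0, 1]

/-- The scalar product `g(v, w)` of tangent vectors at the point with coordinates `q`. -/
def gInner (q v w : V) : ℝ := ∑ i, ∑ j, metric q i j * v i * w j

/-- The partial derivative `∂_i f` at `q`. -/
def partialDeriv (i : Fin 3) (f : V → ℝ) (q : V) : ℝ := fderiv ℝ f q (Pi.single i 1)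

/-- The Christoffel symbol `Γ^k_{ij}` of the Levi-Civita connection of the metric. -/
def christoffel (k i j : Fin 3) (q : V) : ℝ :=
  (1 / 2) * ∑ l, (metric q)⁻¹ k l *
    (partialDeriv i (fun p => metric p j l) q + partialDeriv j (fun p => metric p i l) q
      - partialDeriv l (fun p => metric p i j) q)

/-- The reference frame, orthonormal for the metric away from `L`. With cylindrical coordinates
`(r, φ, z)`: `e₁ = cos φ (∂_r / 2) - sin φ (∂_φ / r)`, `e₂ = sin φ (∂_r / 2) + cos φ (∂_φ / r)`,
`e₃ = ∂_z`. -/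
def frame (q : V) : Fin 3 → V :=
  ![![(q 0 ^ 2 / 2 + q 1 ^ 2) / rSq q, -(q 0 * q 1) / (2 * rSq q), 0],
    ![-(q 0 * q 1) / (2 * rSq q), (q 1 ^ 2 / 2 + q 0 ^ 2) / rSq q, 0],
    ![0, 0, 1]]

/-- The components `g(e_i, v)` of a tangent vector at `q` in the reference frame. -/
def frameComponents (q v : V) : Fin 3 → ℝ := fun i => gInner q (frame q i) v

/-- The curve `γ`, read in the chart. -/
def chartCurve (γ : ℝ → SymMat) : ℝ → V := fun t => chart (γ t)

/-- The velocity `γ'(t)` of a curve, in the chart. -/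
def velocity (γ : ℝ → SymMat) (t : ℝ) : V := deriv (chartCurve γ) t

/-- A piecewise smooth loop `γ : [0, 1] → Sym(2,ℝ)` at `p`, which may cross `L`, but only
at times where it is smooth and where its velocity is not tangent to `L`. -/
structure IsLoopAt (p : SymMat) (γ : ℝ → SymMat) : Prop where
  source : γ 0 = p
  target : γ 1 = p
  piecewise_smooth : ∃ (n : ℕ) (s : ℕ → ℝ), Monotone s ∧ s 0 = 0 ∧ s n = 1 ∧
    (∀ i < n, ContDiffOn ℝ ∞ (chartCurve γ) (Set.Icc (s i) (s (i + 1)))) ∧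
    ∀ i ≤ n, γ (s i) ∉ L
  transverse : ∀ t ∈ Set.Ioo (0 : ℝ) 1, γ t ∈ L → velocity γ t 0 ≠ 0 ∨ velocity γ t 1 ≠ 0

/-- `E` is a parallel vector field along `γ : [0, 1] → Sym(2,ℝ)`: away from `L` it is continuous
and solves `∇_{γ'} E = 0` wherever `γ` is differentiable; where `γ` crosses `L`, its components
in the reference frame extend continuously. -/
structure IsParallelAlong (γ : ℝ → SymMat) (E : ℝ → V) : Prop where
  continuous : ∀ t ∈ Set.Icc (0 : ℝ) 1, γ t ∉ L → ContinuousWithinAt E (Set.Icc 0 1) t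
  parallel : ∀ t ∈ Set.Ioo (0 : ℝ) 1, γ t ∉ L → DifferentiableAt ℝ (chartCurve γ) t →
    HasDerivAt E
      (fun k => -∑ i, ∑ j, christoffel k i j (chartCurve γ t) * velocity γ t i * E t j) t
  crossing : ∀ t ∈ Set.Ioo (0 : ℝ) 1, γ t ∈ L →
    ∃ c : Fin 3 → ℝ,
      Filter.Tendsto (fun u => frameComponents (chartCurve γ u) (E u)) (𝓝[≠] t) (𝓝 c)

/-- `T` is the parallel transport along `γ` from the tangent space at `γ 0` to that at `γ 1`. -/
def IsParallelTransport (γ : ℝ → SymMat) (T : V →ₗ[ℝ] V) : Prop :=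
  ∀ v : V, ∃ E : ℝ → V, IsParallelAlong γ E ∧ E 0 = v ∧ E 1 = T v

/-- The parallel transports around loops at `p` that stay in `U`. -/
def loopTransports (U : Set SymMat) (p : SymMat) : Set (V ≃ₗ[ℝ] V) :=
  {T | ∃ γ : ℝ → SymMat, IsLoopAt p γ ∧ (∀ t ∈ Set.Icc (0 : ℝ) 1, γ t ∈ U) ∧
    IsParallelTransport γ (T : V →ₗ[ℝ] V)}

/-- The holonomy group of `U` at `p`. -/
def holonomyGroup (U : Set SymMat) (p : SymMat) : Subgroup (V ≃ₗ[ℝ] V) :=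
  Subgroup.closure (loopTransports U p)

/-- The angular form `dφ = (x dy - y dx) / r²` on `v`, at `q`. -/
def dphi (q v : V) : ℝ := (q 0 * v 1 - q 1 * v 0) / rSq q

/-- The winding number of `γ` around `L`; it need not be an integer if `γ` crosses `L`. -/
def windingNumber (γ : ℝ → SymMat) : ℝ :=
  (1 / (2 * Real.pi)) * ∫ t in (0 : ℝ)..1, dphi (chartCurve γ t) (velocity γ t)

/-- The rotation by the angle `θ` of the tangent space at `p` in the plane of `e₁, e₂` (from `e₁`
towards `e₂`), fixing `e₃`. -/
def rotation (p : SymMat) (θ : ℝ) : V →ₗ[ℝ] V where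
  toFun v :=
    let c := frameComponents (chart p) v
    (Real.cos θ * c 0 - Real.sin θ * c 1) • frame (chart p) 0
      + (Real.sin θ * c 0 + Real.cos θ * c 1) • frame (chart p) 1
      + c 2 • frame (chart p) 2
  map_add' v w := by
    ext i
    simp [frameComponents, gInner, Fin.sum_univ_three]
    ring
  map_smul' a v := by
    ext i
    simp [frameComponents, gInner, Fin.sum_univ_three]
    ring

end SymHol

end

/-!
In cylindrical coordinates the metric is `4 dr² + r² dφ² + dz²`. Hence the reference frame turns
with respect to the connection at half the angular velocity of the curve around `L`, and the
components of a parallel field are rotated by half the angle that the curve sweeps out around `L`.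

Projecting along `L` leaves a plane curve `w`, whose angular velocity is the imaginary part of
`w' / w`. At a transverse zero of `w` the pole of `w' / w` is real up to a bounded term, so the
swept angle is defined and continuous across `L`. There the direction `w / |w|` is reversed, but its
square has a limit. So the square of the direction, turned back by twice the swept angle, is
constant, and the swept angle of a loop is a multiple of `π`; if the loop avoids `L`, the direction
itself is continuous and the swept angle is a multiple of `2π`. Circles around the origin and
circles through the origin realise these angles.
-/

noncomputable section

namespace SymHol

open Asymptotics Filter MeasureTheory Set

section Calculus

variable {E : Type*} [NormedAddCommGroup E] [NormedSpace ℝ E]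

theorem isBigO_sub_sub_smul_deriv {w : ℝ → E} {t₀ : ℝ} (hw : ContDiffAt ℝ 2 w t₀) :
    (fun t => w t - w t₀ - (t - t₀) • deriv w t) =O[𝓝 t₀] fun t => (t - t₀) ^ 2 := by
  have hw' : ContDiffAt ℝ 1 (deriv w) t₀ :=
    (hw.fderiv_right (m := 1) (by norm_num)).clm_apply (contDiffAt_const (c := (1 : ℝ)))
  have hdiff : ∀ᶠ t in 𝓝 t₀, DifferentiableAt ℝ w t :=
    (hw.eventually (by simp)).mono fun t ht => ht.differentiableAt (by simp)
  obtain ⟨K, s, hs, hK⟩ := hw'.exists_lipschitzOnWith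
  obtain ⟨ε, hε, hball⟩ := Metric.eventually_nhds_iff_ball.1 (hdiff.and hs)
  refine .of_bound K ?_
  filter_upwards [Metric.ball_mem_nhds t₀ hε] with t ht
  have hsub : uIcc t₀ t ⊆ Metric.ball t₀ ε :=
    (convex_ball t₀ ε).ordConnected.uIcc_subset (Metric.mem_ball_self hε) ht
  have hmean := (convex_uIcc t₀ t).norm_image_sub_le_of_norm_hasDerivWithin_le
    (f := fun u => w u - u • deriv w t) (f' := fun u => deriv w u - (1 : ℝ) • deriv w t)
    (C := K * |t - t₀|)
    (fun u hu => ((hball u (hsub hu)).1.hasDerivAt.sub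
      ((hasDerivAt_id u).smul_const (deriv w t))).hasDerivWithinAt)
    (fun u hu => ?_) left_mem_uIcc right_mem_uIcc
  · calc ‖w t - w t₀ - (t - t₀) • deriv w t‖
        = ‖w t - t • deriv w t - (w t₀ - t₀ • deriv w t)‖ := by congr 1; module
      _ ≤ K * |t - t₀| * ‖t - t₀‖ := hmean
      _ = K * ‖(t - t₀) ^ 2‖ := by rw [Real.norm_eq_abs, mul_assoc, ← abs_mul, ← sq]; rfl
  · rw [one_smul, ← dist_eq_norm]
    refine (hK.dist_le_mul u (hball u (hsub hu)).2 t (hball t ht).2).trans ?_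
    rw [Real.dist_eq, abs_sub_comm]
    exact mul_le_mul_of_nonneg_left (abs_sub_right_of_mem_uIcc hu) K.2

theorem isBigO_logDeriv_sub_inv {w : ℝ → ℂ} {t₀ : ℝ} (hw : ContDiffAt ℝ 2 w t₀)
    (h0 : w t₀ = 0) (h1 : deriv w t₀ ≠ 0) :
    (fun t => logDeriv w t - ((t - t₀ : ℝ) : ℂ)⁻¹) =O[𝓝[≠] t₀] fun _ => (1 : ℝ) := by
  have hd : HasDerivAt w (deriv w t₀) t₀ := (hw.differentiableAt (by simp)).hasDerivAt
  have hsub : (fun t => t - t₀) =O[𝓝[≠] t₀] w := by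
    have := (hd.isTheta_sub h1).symm.isBigO.comp_tendsto
      (tendsto_id.prodMk (tendsto_const_pure (a := 𝓝 t₀) (b := t₀)))
    simpa [Function.comp_def, h0] using this.mono nhdsWithin_le_nhds
  have hne : ∀ᶠ t in 𝓝[≠] t₀, t - t₀ ≠ 0 :=
    eventually_mem_nhdsWithin.mono fun t ht => sub_ne_zero.2 ht
  have hden : (fun t => (w t * ((t - t₀ : ℝ) : ℂ))⁻¹) =O[𝓝[≠] t₀] fun t => ((t - t₀) ^ 2)⁻¹ := by
    refine IsBigO.inv_rev ?_ (hne.mono fun t ht h => absurd h (pow_ne_zero 2 ht))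
    simp only [sq]
    exact hsub.mul (isBigO_of_le _ fun t => (Complex.norm_real (t - t₀)).ge)
  refine (((isBigO_sub_sub_smul_deriv hw).mono nhdsWithin_le_nhds).neg_left.mul hden).congr' ?_ ?_
  · filter_upwards [hne, hd.eventually_ne h1 (c := 0)] with t ht hwt
    have : ((t - t₀ : ℝ) : ℂ) ≠ 0 := Complex.ofReal_ne_zero.2 ht
    rw [logDeriv_apply, h0, Complex.real_smul]
    field_simp
    ring
  · filter_upwards [hne] with t ht
    exact mul_inv_cancel₀ (pow_ne_zero 2 ht)

/-- The two-sided limits rule out jumps at the points of `Z`. -/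
theorem eq_of_hasDerivAt_zero_of_tendsto [CompleteSpace E] {f : ℝ → E} {a b : ℝ} (hab : a ≤ b)
    {Z S : Set ℝ} (hZ : Z.Finite) (hZab : Z ⊆ Ioo a b) (hS : S.Countable)
    (hcont : ∀ t ∈ Icc a b \ Z, ContinuousWithinAt f (Icc a b) t)
    (hlim : ∀ t ∈ Z, ∃ l, Tendsto f (𝓝[≠] t) (𝓝 l))
    (hderiv : ∀ t ∈ (Ioo a b \ Z) \ S, HasDerivAt f 0 t) : f b = f a := by
  have hcont' (t : ℝ) (ht : t ∈ Icc a b \ Z) : Tendsto f (𝓝[Icc a b \ Z] t) (𝓝 (f t)) :=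
    (hcont t ht).mono sdiff_subset
  have hext : EqOn (extendFrom (Icc a b \ Z) f) f (Icc a b \ Z) := fun t ht =>
    extendFrom_eq (subset_closure ht) (hcont' t ht)
  have hmem {t : ℝ} (ht : t ∈ Ioo a b) : Icc a b \ Z ∈ 𝓝[≠] t :=
    nhdsNE_of_nhdsNE_sdiff_finite (nhdsWithin_le_nhds (Icc_mem_nhds ht.1 ht.2)) hZ.to_subtype
  have hclosure : Icc a b ⊆ closure (Icc a b \ Z) := by
    intro t ht
    by_cases htZ : t ∈ Z
    · exact mem_closure_iff_nhdsWithin_neBot.2 <|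
        (inferInstance : (𝓝[≠] t).NeBot).mono (nhdsWithin_le_of_mem (hmem (hZab htZ)))
    · exact subset_closure ⟨ht, htZ⟩
  have hext_cont : ContinuousOn (extendFrom (Icc a b \ Z) f) (Icc a b) := by
    refine continuousOn_extendFrom hclosure fun t ht => ?_
    by_cases htZ : t ∈ Z
    · obtain ⟨l, hl⟩ := hlim t htZ
      exact ⟨l, hl.mono_left (nhdsWithin_mono t fun u hu hut => hu.2 (hut ▸ htZ))⟩
    · exact ⟨f t, hcont' t ⟨ht, htZ⟩⟩
  have hint := integral_eq_of_hasDerivAt_off_countable_of_le (extendFrom (Icc a b \ Z) f)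
    (fun _ => (0 : E)) hab (hZ.countable.union hS) hext_cont (fun t ht => ?_) (by simp)
  · have ha : a ∉ Z := fun h => (hZab h).1.false
    have hb : b ∉ Z := fun h => (hZab h).2.false
    rw [intervalIntegral.integral_zero, hext ⟨left_mem_Icc.2 hab, ha⟩,
      hext ⟨right_mem_Icc.2 hab, hb⟩] at hint
    exact sub_eq_zero.1 hint.symm
  · rw [← Set.sdiff_sdiff] at ht
    refine (hderiv t ht).congr_of_eventuallyEq (hext.eventuallyEq_of_mem ?_)
    exact inter_mem (Icc_mem_nhds ht.1.1.1 ht.1.1.2) (hZ.isClosed.isOpen_compl.mem_nhds ht.1.2)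

theorem isBounded_image_deriv_Icc {f : ℝ → E} {a b : ℝ} (hf : ContDiffOn ℝ 1 f (Icc a b)) :
    Bornology.IsBounded (deriv f '' Icc a b) := by
  rcases le_or_gt b a with hab | hab
  · exact ((subsingleton_Icc_of_ge hab).image _).finite.isBounded
  have hcont := hf.continuousOn_derivWithin (uniqueDiffOn_Icc hab) le_rfl
  refine ((isCompact_Icc.image_of_continuousOn hcont).isBounded.union
    ((toFinite {a, b}).image (deriv f)).isBounded).subset ?_
  rintro _ ⟨t, ht, rfl⟩
  rcases eq_endpoints_or_mem_Ioo_of_mem_Icc ht with rfl | rfl | htI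
  · exact .inr ⟨t, by simp, rfl⟩
  · exact .inr ⟨t, by simp, rfl⟩
  · exact .inl ⟨t, ht, derivWithin_of_mem_nhds (Icc_mem_nhds htI.1 htI.2)⟩

theorem biUnion_Icc_succ_eq_Icc {s : ℕ → ℝ} (hs : Monotone s) {n : ℕ} (hn : s 0 < s n) :
    ⋃ i ∈ Ico 0 n, Icc (s i) (s (i + 1)) = Icc (s 0) (s n) := by
  refine Subset.antisymm (iUnion₂_subset fun i hi =>
    Icc_subset_Icc (hs i.zero_le) (hs (Nat.succ_le_of_lt hi.2))) ?_
  rw [← closure_Ioc hn.ne, ← hs.biUnion_Ico_Ioc_map_succ]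
  refine closure_minimal (iUnion₂_mono fun i _ => Ioc_subset_Icc_self) ?_
  exact (finite_Ico 0 n).isClosed_biUnion fun i _ => isClosed_Icc

end Calculus

section PlaneCurves

/-- The rate of change of the argument of `w`: the imaginary part of `w' / w`. It takes the junk
value `0` at the zeros of `w`. -/
def angularVelocity (w : ℝ → ℂ) (t : ℝ) : ℝ := (logDeriv w t).im

/-- The total change of the argument of `w` between the times `a` and `t`. -/
def sweptAngle (w : ℝ → ℂ) (a t : ℝ) : ℝ := ∫ u in a..t, angularVelocity w u

/-- The direction of `w`, turned back by the angle swept since the time `a`. -/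
def unwound (w : ℝ → ℂ) (a t : ℝ) : ℂ :=
  w t / ‖w t‖ * Complex.exp (-(sweptAngle w a t * Complex.I))

/-- A Lipschitz curve on `[a, b]`, differentiable up to a countable set, which passes through the
origin only at interior times, at which it is `C²` and has a nonzero velocity. -/
structure IsTransverseCurve (w : ℝ → ℂ) (a b : ℝ) : Prop where
  continuousOn : ContinuousOn w (Icc a b)
  countable_not_differentiableAt : {t ∈ Ioo a b | ¬DifferentiableAt ℝ w t}.Countable
  bounded_deriv : ∃ M, ∀ t ∈ Icc a b, ‖deriv w t‖ ≤ M
  mem_Ioo : ∀ t ∈ Icc a b, w t = 0 → t ∈ Ioo a b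
  contDiffAt : ∀ t ∈ Icc a b, w t = 0 → ContDiffAt ℝ 2 w t
  deriv_ne_zero : ∀ t ∈ Icc a b, w t = 0 → deriv w t ≠ 0

theorem sweptAngle_self (w : ℝ → ℂ) (a : ℝ) : sweptAngle w a a = 0 :=
  intervalIntegral.integral_same

theorem div_norm_eq_exp_arg_mul_I {z : ℂ} (hz : z ≠ 0) :
    z / ‖z‖ = Complex.exp (z.arg * Complex.I) := by
  rw [div_eq_iff (by simpa using hz), mul_comm, Complex.norm_mul_exp_arg_mul_I]

/-- The direction is reversed when the curve runs through the origin, hence the square. -/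
theorem tendsto_div_norm_sq {w : ℝ → ℂ} {v : ℂ} {t₀ : ℝ} (hw : HasDerivAt w v t₀) (h0 : w t₀ = 0)
    (hv : v ≠ 0) : Tendsto (fun t => (w t / ‖w t‖) ^ 2) (𝓝[≠] t₀) (𝓝 ((v / ‖v‖) ^ 2)) := by
  have hslope : Tendsto (slope w t₀) (𝓝[≠] t₀) (𝓝 v) := hasDerivAt_iff_tendsto_slope.1 hw
  have hnorm : Tendsto (fun t => (‖slope w t₀ t‖ : ℂ)) (𝓝[≠] t₀) (𝓝 ‖v‖) :=
    (Complex.continuous_ofReal.tendsto _).comp hslope.norm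
  refine ((hslope.div hnorm (by simpa using hv)).pow 2).congr' ?_
  filter_upwards [self_mem_nhdsWithin] with t ht
  have hsq : ((|t - t₀| : ℝ) : ℂ) ^ 2 = ((t - t₀ : ℝ) : ℂ) ^ 2 := by
    rw [← Complex.ofReal_pow, sq_abs, Complex.ofReal_pow]
  have hne : ((t - t₀ : ℝ) : ℂ) ^ 2 ≠ 0 :=
    pow_ne_zero 2 (Complex.ofReal_ne_zero.2 (sub_ne_zero.2 ht))
  rw [Pi.div_apply, slope, vsub_eq_sub, h0, sub_zero, norm_smul, norm_inv, Real.norm_eq_abs,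
    Complex.real_smul, Complex.ofReal_mul, Complex.ofReal_inv, Complex.ofReal_inv, div_pow,
    mul_pow, mul_pow, inv_pow, inv_pow, hsq, mul_div_mul_left _ _ (inv_ne_zero hne), div_pow]

/-- At a zero, `w' / w` differs from the real pole `1 / (t - t₀)` by a bounded term, so that its
imaginary part is bounded. -/
theorem isBigO_angularVelocity_nhds_zero {w : ℝ → ℂ} {t₀ : ℝ} (hw : ContDiffAt ℝ 2 w t₀)
    (h0 : w t₀ = 0) (h1 : deriv w t₀ ≠ 0) :
    angularVelocity w =O[𝓝 t₀] fun _ => (1 : ℝ) := by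
  have hpunctured : angularVelocity w =O[𝓝[≠] t₀] fun _ => (1 : ℝ) := by
    refine (isBigO_of_le _ fun t => ?_).trans (isBigO_logDeriv_sub_inv hw h0 h1)
    rw [← Complex.ofReal_inv]
    simpa [angularVelocity] using
      Complex.abs_im_le_norm (logDeriv w t - (((t - t₀)⁻¹ : ℝ) : ℂ))
  rw [← nhdsNE_sup_pure, isBigO_sup, isBigO_pure]
  exact ⟨hpunctured, fun h => absurd h one_ne_zero⟩

theorem hasDerivAt_arg_div {w : ℝ → ℂ} {t : ℝ} {c : ℂ} (hw : DifferentiableAt ℝ w t)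
    (hc : w t / c ∈ Complex.slitPlane) :
    HasDerivAt (fun u => (w u / c).arg) (angularVelocity w t) t := by
  have hc0 : c ≠ 0 := fun h => by simp [h] at hc
  have hlog := (hw.hasDerivAt.div_const c).clog_real hc
  rw [div_div_div_cancel_right₀ hc0] at hlog
  simpa only [← Complex.log_im] using! Complex.imCLM.hasFDerivAt.comp_hasDerivAt t hlog

namespace IsTransverseCurve

variable {w : ℝ → ℂ} {a b t : ℝ}

theorem isBigO_angularVelocity (hw : IsTransverseCurve w a b) (ht : t ∈ Icc a b) :
    angularVelocity w =O[𝓝[Icc a b] t] fun _ => (1 : ℝ) := by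
  by_cases h0 : w t = 0
  · exact (isBigO_angularVelocity_nhds_zero (hw.contDiffAt t ht h0) h0
      (hw.deriv_ne_zero t ht h0)).mono nhdsWithin_le_nhds
  · obtain ⟨M, hM⟩ := hw.bounded_deriv
    have hderiv : deriv w =O[𝓝[Icc a b] t] fun _ => (1 : ℝ) :=
      .of_bound M (eventually_mem_nhdsWithin.mono fun u hu => by simpa using hM u hu)
    have hinv : (fun u => (w u)⁻¹) =O[𝓝[Icc a b] t] fun _ => (1 : ℝ) :=
      ((hw.continuousOn t ht).inv₀ h0).isBigO_one ℝ
    have hprod := hderiv.mul hinv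
    simp only [mul_one, ← div_eq_mul_inv] at hprod
    exact (isBigO_of_le _ fun u => Complex.abs_im_le_norm _).trans hprod

theorem integrableOn_angularVelocity (hw : IsTransverseCurve w a b) :
    IntegrableOn (angularVelocity w) (Icc a b) := by
  have hmeas : AEStronglyMeasurable (angularVelocity w) (volume.restrict (Icc a b)) := by
    have hinv : AEMeasurable (fun u => (w u)⁻¹) (volume.restrict (Icc a b)) :=
      (hw.continuousOn.aemeasurable measurableSet_Icc).inv
    have hlog : AEMeasurable (logDeriv w) (volume.restrict (Icc a b)) :=
      (measurable_deriv w).aemeasurable.mul hinv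
    exact (Complex.measurable_im.comp_aemeasurable hlog).aestronglyMeasurable
  refine LocallyIntegrableOn.integrableOn_isCompact (fun t ht => ?_) isCompact_Icc
  exact (volume.finiteAt_nhdsWithin _ _).integrableAtFilter ⟨Icc a b, self_mem_nhdsWithin, hmeas⟩
    ((isBigO_one_iff ℝ).1 (hw.isBigO_angularVelocity ht))

theorem intervalIntegrable (hw : IsTransverseCurve w a b) {c d : ℝ} (hc : c ∈ Icc a b)
    (hd : d ∈ Icc a b) : IntervalIntegrable (angularVelocity w) volume c d :=
  (hw.integrableOn_angularVelocity.mono_set (uIcc_subset_Icc hc hd)).intervalIntegrable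

theorem continuousOn_sweptAngle (hw : IsTransverseCurve w a b) (hab : a ≤ b) :
    ContinuousOn (sweptAngle w a) (Icc a b) := by
  rw [← uIcc_of_le hab]
  exact intervalIntegral.continuousOn_primitive_interval
    (by simpa only [uIcc_of_le hab] using hw.integrableOn_angularVelocity)

theorem finite_zeros (hw : IsTransverseCurve w a b) : {t ∈ Icc a b | w t = 0}.Finite := by
  have hclosed : IsClosed {t ∈ Icc a b | w t = 0} :=
    hw.continuousOn.preimage_isClosed_of_isClosed isClosed_Icc isClosed_singleton
  refine (isCompact_Icc.of_isClosed_subset hclosed fun t ht => ht.1).finite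
    (isDiscrete_iff_nhdsNE.2 fun t ⟨ht, h0⟩ => ?_)
  have hd := ((hw.contDiffAt t ht h0).differentiableAt (by simp)).hasDerivAt
  rw [← disjoint_iff, disjoint_principal_right]
  filter_upwards [hd.eventually_ne (hw.deriv_ne_zero t ht h0) (c := 0)] with u hu huZ
  exact hu huZ.2

theorem eventually_sweptAngle_eq (hw : IsTransverseCurve w a b) (ht : t ∈ Icc a b)
    (h0 : w t ≠ 0) : ∀ᶠ u in 𝓝[Icc a b] t,
      w u / w t ∈ Complex.slitPlane ∧
        sweptAngle w a u = sweptAngle w a t + (w u / w t).arg := by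
  have hcont : ContinuousOn (fun u => w u / w t) (Icc a b) := hw.continuousOn.div_const _
  have hslit : ∀ᶠ u in 𝓝[Icc a b] t, w u / w t ∈ Complex.slitPlane :=
    (hcont t ht).eventually_mem (Complex.isOpen_slitPlane.mem_nhds (by simp [h0]))
  obtain ⟨ε, hε, hball⟩ := Metric.eventually_nhds_iff_ball.1 (eventually_nhdsWithin_iff.1 hslit)
  filter_upwards [nhdsWithin_le_nhds (Metric.ball_mem_nhds t hε), self_mem_nhdsWithin]
    with u hu huI
  have hsub : uIcc t u ⊆ Metric.ball t ε :=
    (convex_ball t ε).ordConnected.uIcc_subset (Metric.mem_ball_self hε) hu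
  have hsubI : uIcc t u ⊆ Icc a b := uIcc_subset_Icc ht huI
  have hslit' (v) (hv : v ∈ uIcc t u) : w v / w t ∈ Complex.slitPlane :=
    hball v (hsub hv) (hsubI hv)
  have hint := integral_eq_of_hasDerivAt_off_countable (fun v => (w v / w t).arg)
    (angularVelocity w) hw.countable_not_differentiableAt
    (fun v hv => (Complex.continuousAt_arg (hslit' v hv)).comp_continuousWithinAt
      (f := fun v => w v / w t) (hcont.mono hsubI v hv))
    (fun v hv => hasDerivAt_arg_div ?_ (hslit' v (Ioo_subset_Icc_self hv.1)))
    (hw.intervalIntegrable ht huI)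
  · refine ⟨hball u hu huI, ?_⟩
    rw [div_self h0, Complex.arg_one, sub_zero] at hint
    rw [← hint]
    exact (intervalIntegral.integral_add_adjacent_intervals
      (hw.intervalIntegrable (left_mem_Icc.2 (ht.1.trans ht.2)) ht)
      (hw.intervalIntegrable ht huI)).symm
  · by_contra hdiff
    exact hv.2 ⟨Ioo_subset_Ioo (le_min ht.1 huI.1) (max_le ht.2 huI.2) hv.1, hdiff⟩

theorem hasDerivAt_sweptAngle (hw : IsTransverseCurve w a b) (ht : t ∈ Ioo a b) (h0 : w t ≠ 0)
    (hd : DifferentiableAt ℝ w t) : HasDerivAt (sweptAngle w a) (angularVelocity w t) t := by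
  have hev := hw.eventually_sweptAngle_eq (Ioo_subset_Icc_self ht) h0
  rw [nhdsWithin_eq_nhds.2 (Icc_mem_nhds ht.1 ht.2)] at hev
  exact ((hasDerivAt_arg_div hd (by simp [h0])).const_add _).congr_of_eventuallyEq
    (hev.mono fun u hu => hu.2)

theorem eventually_unwound_eq (hw : IsTransverseCurve w a b) (ht : t ∈ Icc a b) (h0 : w t ≠ 0) :
    ∀ᶠ u in 𝓝[Icc a b] t, unwound w a u = unwound w a t := by
  filter_upwards [hw.eventually_sweptAngle_eq ht h0] with u ⟨hslit, hu⟩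
  have hdirection : w u / ‖w u‖ = w t / ‖w t‖ * Complex.exp ((w u / w t).arg * Complex.I) := by
    rw [← div_norm_eq_exp_arg_mul_I (Complex.slitPlane_ne_zero hslit), norm_div,
      Complex.ofReal_div, div_mul_div_comm, mul_div_cancel₀ _ h0, mul_div_cancel₀ _ (by simpa)]
  rw [unwound, unwound, hu, hdirection, mul_assoc, ← Complex.exp_add]
  congr 2
  push_cast
  ring

theorem continuousWithinAt_unwound (hw : IsTransverseCurve w a b) (ht : t ∈ Icc a b)
    (h0 : w t ≠ 0) : ContinuousWithinAt (unwound w a) (Icc a b) t :=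
  continuousWithinAt_const.congr_of_eventuallyEq (hw.eventually_unwound_eq ht h0) rfl

theorem hasDerivAt_unwound (hw : IsTransverseCurve w a b) (ht : t ∈ Ioo a b) (h0 : w t ≠ 0) :
    HasDerivAt (unwound w a) 0 t := by
  have hev := hw.eventually_unwound_eq (Ioo_subset_Icc_self ht) h0
  rw [nhdsWithin_eq_nhds.2 (Icc_mem_nhds ht.1 ht.2)] at hev
  exact (hasDerivAt_const t (unwound w a t)).congr_of_eventuallyEq hev

theorem tendsto_unwound_sq (hw : IsTransverseCurve w a b) (ht : t ∈ Icc a b) (h0 : w t = 0) :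
    ∃ l, Tendsto (fun u => unwound w a u ^ 2) (𝓝[≠] t) (𝓝 l) := by
  have ht' := hw.mem_Ioo t ht h0
  have hd := ((hw.contDiffAt t ht h0).differentiableAt (by simp)).hasDerivAt
  have hangle : ContinuousAt (sweptAngle w a) t :=
    (hw.continuousOn_sweptAngle (ht.1.trans ht.2)).continuousAt (Icc_mem_nhds ht'.1 ht'.2)
  have hexp : ContinuousAt (fun u => Complex.exp (-(sweptAngle w a u * Complex.I)) ^ 2) t := by
    fun_prop
  simp only [unwound, mul_pow]
  exact ⟨_, (tendsto_div_norm_sq hd h0 (hw.deriv_ne_zero t ht h0)).mul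
    (hexp.tendsto.mono_left nhdsWithin_le_nhds)⟩

end IsTransverseCurve

theorem unwound_right {w : ℝ → ℂ} {a b : ℝ} (hab : w b = w a) :
    unwound w a b = unwound w a a * Complex.exp (-(sweptAngle w a b * Complex.I)) := by
  simp [unwound, hab, sweptAngle_self]

theorem unwound_left_ne_zero {w : ℝ → ℂ} {a : ℝ} (ha : w a ≠ 0) : unwound w a a ≠ 0 := by
  simp [unwound, ha]

namespace IsTransverseCurve

variable {w : ℝ → ℂ} {a b : ℝ}

theorem exists_sweptAngle_eq_int_mul_pi (hw : IsTransverseCurve w a b) (hab : a ≤ b)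
    (hclosed : w b = w a) : ∃ k : ℤ, sweptAngle w a b = k * Real.pi := by
  have ha : w a ≠ 0 := fun h => (hw.mem_Ioo a (left_mem_Icc.2 hab) h).1.false
  have hconst : unwound w a b ^ 2 = unwound w a a ^ 2 :=
    eq_of_hasDerivAt_zero_of_tendsto hab hw.finite_zeros (fun t ht => hw.mem_Ioo t ht.1 ht.2)
      countable_empty
      (fun t ht => (hw.continuousWithinAt_unwound ht.1 fun h => ht.2 ⟨ht.1, h⟩).pow 2)
      (fun t ht => hw.tendsto_unwound_sq ht.1 ht.2)
      fun t ht => ((hw.hasDerivAt_unwound ht.1.1 fun h =>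
        ht.1.2 ⟨Ioo_subset_Icc_self ht.1.1, h⟩).pow 2).congr_deriv (by simp)
  rw [unwound_right hclosed, mul_pow, mul_eq_left₀ (pow_ne_zero 2 (unwound_left_ne_zero ha)),
    ← Complex.exp_nat_mul, Complex.exp_eq_one_iff] at hconst
  obtain ⟨n, hn⟩ := hconst
  have him : 2 * -sweptAngle w a b = n * (2 * Real.pi) := by simpa using congrArg Complex.im hn
  exact ⟨-n, by push_cast; linarith⟩

theorem exists_sweptAngle_eq_int_mul_two_pi (hw : IsTransverseCurve w a b) (hab : a ≤ b)
    (hclosed : w b = w a) (h0 : ∀ t ∈ Icc a b, w t ≠ 0) :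
    ∃ k : ℤ, sweptAngle w a b = k * (2 * Real.pi) := by
  have hconst : unwound w a b = unwound w a a :=
    eq_of_hasDerivAt_zero_of_tendsto hab finite_empty (empty_subset _) countable_empty
      (fun t ht => hw.continuousWithinAt_unwound ht.1 (h0 t ht.1)) (fun t ht => ht.elim)
      fun t ht => hw.hasDerivAt_unwound ht.1.1 (h0 t (Ioo_subset_Icc_self ht.1.1))
  rw [unwound_right hclosed, mul_eq_left₀ (unwound_left_ne_zero (h0 a (left_mem_Icc.2 hab))),
    Complex.exp_eq_one_iff] at hconst
  obtain ⟨n, hn⟩ := hconst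
  have him : -sweptAngle w a b = n * (2 * Real.pi) := by simpa using congrArg Complex.im hn
  exact ⟨-n, by push_cast; linarith⟩

end IsTransverseCurve

/-- The plane curve that starts from `c * ρ 0`, turns around the origin with the angular velocity
`α` and has the signed distance `‖c‖ * ρ t` to the origin. -/
def spiral (c : ℂ) (α : ℝ) (ρ : ℝ → ℝ) (t : ℝ) : ℂ := c * ρ t * Complex.exp (α * t * Complex.I)

theorem hasDerivAt_spiral {c : ℂ} {α ρ' t : ℝ} {ρ : ℝ → ℝ} (hρ : HasDerivAt ρ ρ' t) :
    HasDerivAt (spiral c α ρ)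
      (c * (ρ' + α * ρ t * Complex.I) * Complex.exp (α * t * Complex.I)) t := by
  have hexp := (((hasDerivAt_id t).ofReal_comp.const_mul (α : ℂ)).mul_const Complex.I).cexp
  refine ((hρ.ofReal_comp.const_mul c).mul hexp).congr_deriv ?_
  simp only [id, Complex.ofReal_one]
  ring

theorem angularVelocity_spiral {c : ℂ} {α t : ℝ} {ρ : ℝ → ℝ} (hc : c ≠ 0)
    (hd : DifferentiableAt ℝ ρ t) (h0 : ρ t ≠ 0) :
    angularVelocity (spiral c α ρ) t = α := by
  have hlog : logDeriv (spiral c α ρ) t = ((deriv ρ t / ρ t : ℝ) : ℂ) + α * Complex.I := by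
    have : Complex.exp (α * t * Complex.I) ≠ 0 := Complex.exp_ne_zero _
    have hρ : (ρ t : ℂ) ≠ 0 := Complex.ofReal_ne_zero.2 h0
    rw [logDeriv_apply, (hasDerivAt_spiral hd.hasDerivAt).deriv, spiral]
    push_cast
    field_simp
  simp [angularVelocity, hlog]

theorem sweptAngle_spiral {c : ℂ} {α a b : ℝ} {ρ : ℝ → ℝ} (hc : c ≠ 0) (hd : Differentiable ℝ ρ)
    (h0 : ∀ᵐ t, t ∈ uIoc a b → ρ t ≠ 0) : sweptAngle (spiral c α ρ) a b = (b - a) * α := by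
  rw [sweptAngle, intervalIntegral.integral_congr_ae (g := fun _ => α)
    (h0.mono fun t ht htI => angularVelocity_spiral hc (hd t) (ht htI)),
    intervalIntegral.integral_const, smul_eq_mul]

end PlaneCurves

section Connection

open ContinuousLinearMap (proj)

/-- The vector field `r ∂_r`; as a linear map, the projection along the axis. -/
def radialField : V →L[ℝ] V := .pi ![proj 0, proj 1, 0]

/-- The vector field `∂_φ`; as a linear map, the infinitesimal rotation about the axis. -/
def rotationField : V →L[ℝ] V := .pi ![-proj 1, proj 0, 0]

/-- The form `dr / r = (x dx + y dy) / r²` at `q`. -/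
def dlogr (q : V) : V →L[ℝ] ℝ := (rSq q)⁻¹ • (q 0 • proj 0 + q 1 • proj 1)

/-- The Christoffel symbols as a bilinear form: `Γ(u, v) = ∇_u v` for a field `v` with constant
coordinates. -/
def christoffelForm (q u v : V) : V := fun k => ∑ i, ∑ j, christoffel k i j q * u i * v j

/-- The tangent vector at `q` with the given components in the reference frame. -/
def ofComponents (q : V) (a : Fin 3 → ℝ) : V := ∑ i, a i • frame q i

/-- The rotation by the angle `θ` about the third axis. -/
def rotate (θ : ℝ) (a : Fin 3 → ℝ) : Fin 3 → ℝ :=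
  ![Real.cos θ * a 0 - Real.sin θ * a 1, Real.sin θ * a 0 + Real.cos θ * a 1, a 2]

theorem radialField_apply (v : V) : radialField v = ![v 0, v 1, 0] := by
  ext i; fin_cases i <;> rfl

theorem rotationField_apply (v : V) : rotationField v = ![-v 1, v 0, 0] := by
  ext i; fin_cases i <;> rfl

theorem dlogr_apply (q v : V) : dlogr q v = (q 0 * v 0 + q 1 * v 1) / rSq q := by
  rw [div_eq_inv_mul]; rfl

theorem rotationField_radialField (v : V) : rotationField (radialField v) = rotationField v := by
  simp [radialField_apply, rotationField_apply]

theorem rotationField_rotationField (v : V) :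
    rotationField (rotationField v) = -radialField v := by
  simp [radialField_apply, rotationField_apply]

theorem dphi_eq_sum (q v : V) : dphi q v = ∑ i, rotationField q i * v i / rSq q := by
  rw [dphi, Fin.sum_univ_three]
  change _ = -q 1 * v 0 / rSq q + q 0 * v 1 / rSq q + 0 * v 2 / rSq q
  ring

theorem rSq_eq_zero_iff {q : V} : rSq q = 0 ↔ q 0 = 0 ∧ q 1 = 0 := by
  simp only [rSq, add_eq_zero_iff_of_nonneg (sq_nonneg (q 0)) (sq_nonneg (q 1)), sq_eq_zero_iff]

theorem continuous_rSq : Continuous rSq := by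
  unfold rSq
  fun_prop

section OffAxis

variable {q : V}

theorem dlogr_radialField (hq : rSq q ≠ 0) : dlogr q (radialField q) = 1 := by
  rw [dlogr_apply, radialField_apply, div_eq_one_iff_eq hq, rSq]
  simp [sq]

theorem radialField_decomposition (hq : rSq q ≠ 0) (v : V) :
    radialField v = dlogr q v • radialField q + dphi q v • rotationField q := by
  have hr : q 0 ^ 2 + q 1 ^ 2 ≠ 0 := hq
  ext i
  fin_cases i <;>
    simp [radialField_apply, rotationField_apply, dlogr_apply, dphi, rSq] <;> field_simp <;> ring

theorem rotationField_decomposition (hq : rSq q ≠ 0) (v : V) :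
    rotationField v = dlogr q v • rotationField q - dphi q v • radialField q := by
  rw [← rotationField_radialField v, radialField_decomposition hq v]
  simp only [map_add, map_smul, rotationField_radialField, rotationField_rotationField]
  module

theorem metric_apply (q : V) (i j : Fin 3) : metric q i j =
    (1 : Matrix (Fin 3) (Fin 3) ℝ) i j + 3 * radialField q i * radialField q j / rSq q := by
  fin_cases i <;> fin_cases j <;> simp [metric, radialField_apply] <;> ring

theorem det_metric (hq : rSq q ≠ 0) : (metric q).det = 4 := by
  have hr : q 0 ^ 2 + q 1 ^ 2 ≠ 0 := hq
  simp only [metric, rSq, Matrix.det_fin_three, Matrix.of_apply, Matrix.cons_val', Matrix.cons_val,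
    Matrix.cons_val_zero, Matrix.cons_val_one, Matrix.cons_val_fin_one]
  field_simp
  ring

theorem metric_mulVec (hq : rSq q ≠ 0) (v : V) :
    (metric q).mulVec v = v + (3 * dlogr q v) • radialField q := by
  ext i
  fin_cases i <;>
    simp [Matrix.mulVec, dotProduct, Fin.sum_univ_three, metric, radialField_apply, dlogr_apply] <;>
    field_simp <;> ring

theorem metric_inv_mulVec_radialField (hq : rSq q ≠ 0) :
    ((metric q)⁻¹).mulVec (radialField q) = (1 / 4 : ℝ) • radialField q := by
  have hunit : IsUnit (metric q).det := by simp [det_metric hq]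
  have hmul : (metric q).mulVec ((1 / 4 : ℝ) • radialField q) = radialField q := by
    rw [metric_mulVec hq, map_smul, dlogr_radialField hq]
    module
  nth_rw 1 [← hmul]
  rw [Matrix.mulVec_mulVec, Matrix.nonsing_inv_mul _ hunit, Matrix.one_mulVec]

theorem hasFDerivAt_rSq (q : V) :
    HasFDerivAt rSq
      ((2 * q 0) • proj (R := ℝ) (φ := fun _ : Fin 3 => ℝ) 0 + (2 * q 1) • proj 1) q := by
  have hproj (l : Fin 3) : HasFDerivAt (fun p : V => p l) (proj (R := ℝ) l) q :=
    (proj (R := ℝ) (φ := fun _ : Fin 3 => ℝ) l).hasFDerivAt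
  exact (((hproj 0).pow 2).add ((hproj 1).pow 2)).congr_fderiv (by simp)

theorem partialDeriv_metric (hq : rSq q ≠ 0) (k i j : Fin 3) :
    partialDeriv k (fun p => metric p i j) q =
      3 * (radialField (Pi.single k 1) i * radialField q j
        + radialField q i * radialField (Pi.single k 1) j) / rSq q
        - 6 * radialField q i * radialField q j * radialField q k / rSq q ^ 2 := by
  have hrad (l : Fin 3) : HasFDerivAt (fun p : V => radialField p l)
      ((proj l).comp radialField) q :=
    ((proj (R := ℝ) (φ := fun _ : Fin 3 => ℝ) l).comp radialField).hasFDerivAt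
  have hmetric := ((((hrad i).const_mul 3).mul (hrad j)).mul
    ((hasFDerivAt_inv hq).comp q (hasFDerivAt_rSq q))).const_add
      ((1 : Matrix (Fin 3) (Fin 3) ℝ) i j)
  have hk : q 0 * (Pi.single k (1 : ℝ) : V) 0 + q 1 * (Pi.single k (1 : ℝ) : V) 1
      = radialField q k := by
    fin_cases k <;> simp [radialField_apply]
  simp only [partialDeriv, metric_apply, div_eq_mul_inv]
  refine (congrArg (fun D : V →L[ℝ] ℝ => D (Pi.single k 1)) hmetric.fderiv).trans ?_
  simp only [ContinuousLinearMap.comp_add, ContinuousLinearMap.comp_smul, smul_add, add_apply,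
    smul_apply, ContinuousLinearMap.comp_apply, ContinuousLinearMap.proj_apply,
    ContinuousLinearMap.toSpanSingleton_apply, Function.comp_apply, Pi.mul_apply, smul_eq_mul]
  rw [← hk]
  field_simp
  ring

theorem partialDeriv_metric_add_sub (hq : rSq q ≠ 0) (i j l : Fin 3) :
    partialDeriv i (fun p => metric p j l) q + partialDeriv j (fun p => metric p i l) q
        - partialDeriv l (fun p => metric p i j) q
      = 6 * (rotationField q i * rotationField q j / rSq q ^ 2) * radialField q l := by
  simp only [partialDeriv_metric hq]
  have hr : q 0 ^ 2 + q 1 ^ 2 ≠ 0 := hq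
  unfold rSq
  fin_cases i <;> fin_cases j <;> fin_cases l <;>
    simp [radialField_apply, rotationField_apply] <;> field_simp <;> ring

theorem christoffel_eq (hq : rSq q ≠ 0) (k i j : Fin 3) : christoffel k i j q =
    3 / 4 * (rotationField q i * rotationField q j / rSq q ^ 2) * radialField q k := by
  have hinv : ∑ l, (metric q)⁻¹ k l * radialField q l = 1 / 4 * radialField q k :=
    congrFun (metric_inv_mulVec_radialField hq) k
  calc christoffel k i j q
      = 3 * (rotationField q i * rotationField q j / rSq q ^ 2) *
          ∑ l, (metric q)⁻¹ k l * radialField q l := by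
        simp only [christoffel, partialDeriv_metric_add_sub hq, Finset.mul_sum]
        exact Finset.sum_congr rfl fun l _ => by ring
    _ = 3 / 4 * (rotationField q i * rotationField q j / rSq q ^ 2) * radialField q k := by
        rw [hinv]
        ring

theorem christoffelForm_eq (hq : rSq q ≠ 0) (u v : V) :
    christoffelForm q u v = (3 / 4 * dphi q u * dphi q v) • radialField q := by
  ext k
  have hsum : ∑ i, ∑ j, rotationField q i * u i / rSq q * (rotationField q j * v j / rSq q)
      = dphi q u * dphi q v := by
    rw [dphi_eq_sum, dphi_eq_sum, Finset.sum_mul_sum]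
  rw [Pi.smul_apply, smul_eq_mul, mul_assoc (3 / 4 : ℝ), ← hsum]
  simp only [christoffelForm, christoffel_eq hq, Finset.mul_sum, Finset.sum_mul]
  exact Finset.sum_congr rfl fun i _ => Finset.sum_congr rfl fun j _ => by ring

theorem frameComponents_eq (hq : rSq q ≠ 0) (v : V) :
    frameComponents q v = v + dlogr q v • radialField q := by
  have hr : q 0 ^ 2 + q 1 ^ 2 ≠ 0 := hq
  ext i
  fin_cases i <;>
    simp [frameComponents, gInner, Fin.sum_univ_three, frame, metric, radialField_apply,
      dlogr_apply, rSq] <;> field_simp <;> ring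

theorem ofComponents_eq (hq : rSq q ≠ 0) (a : Fin 3 → ℝ) :
    ofComponents q a = a - (dlogr q a / 2) • radialField q := by
  have hr : q 0 ^ 2 + q 1 ^ 2 ≠ 0 := hq
  ext i
  fin_cases i <;>
    simp [ofComponents, Fin.sum_univ_three, frame, radialField_apply, dlogr_apply, rSq] <;>
    field_simp <;> ring

theorem frameComponents_ofComponents (hq : rSq q ≠ 0) (a : Fin 3 → ℝ) :
    frameComponents q (ofComponents q a) = a := by
  rw [frameComponents_eq hq, ofComponents_eq hq, map_sub, map_smul, dlogr_radialField hq]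
  module

theorem ofComponents_frameComponents (hq : rSq q ≠ 0) (v : V) :
    ofComponents q (frameComponents q v) = v := by
  rw [ofComponents_eq hq, frameComponents_eq hq, map_add, map_smul, dlogr_radialField hq]
  module

theorem differentiableAt_dlogr (hq : rSq q ≠ 0) (v : V) :
    DifferentiableAt ℝ (fun x : V × V => dlogr x.1 x.2) (q, v) := by
  simp only [dlogr_apply, rSq]
  fun_prop (disch := exact hq)

theorem differentiableAt_frameComponents (hq : rSq q ≠ 0) (v : V) :
    DifferentiableAt ℝ (fun x : V × V => frameComponents x.1 x.2) (q, v) := by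
  have hne : ∀ᶠ x : V × V in 𝓝 (q, v), rSq x.1 ≠ 0 :=
    (continuous_rSq.comp continuous_fst).continuousAt.eventually_ne hq
  refine DifferentiableAt.congr_of_eventuallyEq ?_
    (hne.mono fun x hx => frameComponents_eq hx x.2)
  have := differentiableAt_dlogr hq v
  fun_prop

theorem differentiableAt_ofComponents (hq : rSq q ≠ 0) (a : Fin 3 → ℝ) :
    DifferentiableAt ℝ (fun x : V × V => ofComponents x.1 x.2) (q, a) := by
  have hne : ∀ᶠ x : V × V in 𝓝 (q, a), rSq x.1 ≠ 0 :=
    (continuous_rSq.comp continuous_fst).continuousAt.eventually_ne hq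
  refine DifferentiableAt.congr_of_eventuallyEq ?_ (hne.mono fun x hx => ofComponents_eq hx x.2)
  have := differentiableAt_dlogr hq a
  fun_prop

end OffAxis

section AlongCurve

variable {q E : ℝ → V} {u E' : V} {t : ℝ}

theorem hasDerivAt_dlogr (hr : rSq (q t) ≠ 0) (hq : HasDerivAt q u t) (hE : HasDerivAt E E' t) :
    HasDerivAt (fun s => dlogr (q s) (E s))
      (dlogr (q t) E' + dphi (q t) u * dphi (q t) (E t) - dlogr (q t) u * dlogr (q t) (E t)) t := by
  have hqi := hasDerivAt_pi.1 hq
  have hEi := hasDerivAt_pi.1 hE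
  simp only [dlogr_apply]
  refine ((((hqi 0).mul (hEi 0)).add ((hqi 1).mul (hEi 1))).div
    (((hqi 0).pow 2).add ((hqi 1).pow 2)) hr).congr_deriv ?_
  have hr' : q t 0 ^ 2 + q t 1 ^ 2 ≠ 0 := hr
  simp only [Pi.add_apply, Pi.mul_apply, Pi.pow_apply, dphi, rSq]
  field_simp
  ring

/-- The frame turns at half the angular velocity of the curve with respect to the connection. -/
theorem hasDerivAt_frameComponents (hr : rSq (q t) ≠ 0) (hq : HasDerivAt q u t)
    (hE : HasDerivAt E E' t) :
    HasDerivAt (fun s => frameComponents (q s) (E s))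
      (frameComponents (q t) (E' + christoffelForm (q t) u (E t))
        + (dphi (q t) u / 2) • rotationField (frameComponents (q t) (E t))) t := by
  have hne : ∀ᶠ s in 𝓝 t, rSq (q s) ≠ 0 :=
    (continuous_rSq.continuousAt.comp hq.continuousAt).eventually_ne hr
  have hderiv := hE.add ((hasDerivAt_dlogr hr hq hE).smul
    (radialField.hasFDerivAt.comp_hasDerivAt t hq))
  refine (hderiv.congr_of_eventuallyEq
    (hne.mono fun s hs => frameComponents_eq hs (E s))).congr_deriv ?_
  simp only [frameComponents_eq hr, christoffelForm_eq hr, map_add, map_smul,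
    rotationField_radialField, dlogr_radialField hr, Function.comp_apply]
  rw [radialField_decomposition hr u, rotationField_decomposition hr (E t)]
  module

theorem hasDerivAt_neg_christoffelForm_iff (hr : rSq (q t) ≠ 0) (hq : HasDerivAt q u t) :
    HasDerivAt E (-christoffelForm (q t) u (E t)) t ↔
      HasDerivAt (fun s => frameComponents (q s) (E s))
        ((dphi (q t) u / 2) • rotationField (frameComponents (q t) (E t))) t := by
  constructor
  · intro hE
    refine (hasDerivAt_frameComponents hr hq hE).congr_deriv ?_
    rw [neg_add_cancel, frameComponents_eq hr, map_zero, zero_smul, add_zero, zero_add]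
  · intro hc
    have hne : ∀ᶠ s in 𝓝 t, rSq (q s) ≠ 0 :=
      (continuous_rSq.continuousAt.comp hq.continuousAt).eventually_ne hr
    have hdiff : DifferentiableAt ℝ E t :=
      ((differentiableAt_ofComponents hr _).comp t
        (f := fun s => (q s, frameComponents (q s) (E s)))
        (hq.differentiableAt.prodMk hc.differentiableAt)).congr_of_eventuallyEq
        (hne.mono fun s hs => (ofComponents_frameComponents hs (E s)).symm)
    have hunique := (hasDerivAt_frameComponents hr hq hdiff.hasDerivAt).unique hc
    rw [add_eq_right] at hunique
    have hzero : deriv E t + christoffelForm (q t) u (E t) = 0 := by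
      rw [← ofComponents_frameComponents hr (deriv E t + _), hunique]
      simp [ofComponents]
    rw [← eq_neg_of_add_eq_zero_left hzero]
    exact hdiff.hasDerivAt

end AlongCurve

theorem rotate_rotate (θ η : ℝ) (a : Fin 3 → ℝ) : rotate θ (rotate η a) = rotate (θ + η) a := by
  ext i
  fin_cases i <;> simp [rotate, Real.cos_add, Real.sin_add] <;> ring

theorem rotate_zero (a : Fin 3 → ℝ) : rotate 0 a = a := by
  ext i
  fin_cases i <;> simp [rotate]

theorem rotate_const_zero (θ : ℝ) : rotate θ 0 = 0 := by
  ext i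
  fin_cases i <;> simp [rotate]

theorem rotate_smul_rotationField (θ c : ℝ) (a : Fin 3 → ℝ) :
    rotate θ (c • rotationField a) = c • rotationField (rotate θ a) := by
  ext i
  fin_cases i <;> simp [rotate, rotationField_apply] <;> ring

theorem tendsto_rotate {ι : Type*} {l : Filter ι} {θ : ι → ℝ} {a : ι → Fin 3 → ℝ} {θ₀ : ℝ}
    {a₀ : Fin 3 → ℝ} (hθ : Tendsto θ l (𝓝 θ₀)) (ha : Tendsto a l (𝓝 a₀)) :
    Tendsto (fun i => rotate (θ i) (a i)) l (𝓝 (rotate θ₀ a₀)) := by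
  have hcont : Continuous fun x : ℝ × (Fin 3 → ℝ) => rotate x.1 x.2 := by
    refine continuous_pi fun i => ?_
    fin_cases i
    · change Continuous fun x : ℝ × V => Real.cos x.1 * x.2 0 - Real.sin x.1 * x.2 1
      fun_prop
    · change Continuous fun x : ℝ × V => Real.sin x.1 * x.2 0 + Real.cos x.1 * x.2 1
      fun_prop
    · change Continuous fun x : ℝ × V => x.2 2
      fun_prop
  simpa only [Function.comp_def] using (hcont.tendsto (θ₀, a₀)).comp (hθ.prodMk_nhds ha)

theorem hasDerivAt_rotate {θ : ℝ → ℝ} {a : ℝ → Fin 3 → ℝ} {θ' t : ℝ} {a' : Fin 3 → ℝ}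
    (hθ : HasDerivAt θ θ' t) (ha : HasDerivAt a a' t) :
    HasDerivAt (fun s => rotate (θ s) (a s)) (rotate (θ t) (a' + θ' • rotationField (a t))) t := by
  have hai := hasDerivAt_pi.1 ha
  refine hasDerivAt_pi.2 fun k => ?_
  fin_cases k
  · refine ((hθ.cos.mul (hai 0)).sub (hθ.sin.mul (hai 1))).congr_deriv ?_
    change _ = Real.cos (θ t) * (a' 0 + θ' * -a t 1) - Real.sin (θ t) * (a' 1 + θ' * a t 0)
    ring
  · refine ((hθ.sin.mul (hai 0)).add (hθ.cos.mul (hai 1))).congr_deriv ?_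
    change _ = Real.sin (θ t) * (a' 0 + θ' * -a t 1) + Real.cos (θ t) * (a' 1 + θ' * a t 0)
    ring
  · refine (hai 2).congr_deriv ?_
    simp [rotate, rotationField_apply]

theorem rotation_apply (p : SymMat) (θ : ℝ) (v : V) :
    rotation p θ v = ofComponents (chart p) (rotate θ (frameComponents (chart p) v)) := by
  simp [rotation, ofComponents, rotate, Fin.sum_univ_three]

end Connection

section Loops

open ContinuousLinearMap (proj)

/-- The projection `(x, y, z) ↦ x + i y` along the axis. -/
def planar : V →L[ℝ] ℂ :=
  Complex.equivRealProdCLM.symm.toContinuousLinearMap.comp ((proj 0).prod (proj 1))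

/-- The curve `γ`, projected to the plane along the line of scalar matrices. -/
def planarCurve (γ : ℝ → SymMat) (t : ℝ) : ℂ := planar (chartCurve γ t)

/-- The angle by which a parallel field along `γ` has turned in the reference frame at the time
`t`. -/
def turning (γ : ℝ → SymMat) (t : ℝ) : ℝ := sweptAngle (planarCurve γ) 0 t / 2

theorem planar_apply (q : V) : planar q = ⟨q 0, q 1⟩ := rfl

theorem planar_eq_zero_iff {q : V} : planar q = 0 ↔ q 0 = 0 ∧ q 1 = 0 := by
  rw [Complex.ext_iff, planar_apply, Complex.zero_re, Complex.zero_im]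

theorem dphi_eq_im_div (q v : V) : dphi q v = (planar v / planar q).im := by
  simp only [dphi, Complex.div_im, planar_apply, Complex.normSq_apply, rSq]
  ring

theorem mem_L_iff {A : SymMat} : A ∈ L ↔ planar (chart A) = 0 := by
  rw [planar_eq_zero_iff]
  constructor
  · rintro ⟨c, hc⟩
    simp [chart, hc]
  · rintro ⟨h0, h1⟩
    simp only [chart, Equiv.coe_fn_mk, Matrix.cons_val_zero, Matrix.cons_val_one] at h0 h1
    refine ⟨A.1 0 0, ?_⟩
    ext i j
    fin_cases i <;> fin_cases j <;> simp [A.2.apply 0 1, h1]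
    linarith

theorem notMem_L_iff {A : SymMat} : A ∉ L ↔ rSq (chart A) ≠ 0 := by
  rw [mem_L_iff, planar_eq_zero_iff, ← rSq_eq_zero_iff]

theorem hasDerivAt_planarCurve {γ : ℝ → SymMat} {t : ℝ}
    (hd : DifferentiableAt ℝ (chartCurve γ) t) :
    HasDerivAt (planarCurve γ) (planar (velocity γ t)) t :=
  planar.hasFDerivAt.comp_hasDerivAt t hd.hasDerivAt

theorem angularVelocity_planarCurve {γ : ℝ → SymMat} {t : ℝ}
    (hd : DifferentiableAt ℝ (chartCurve γ) t) :
    angularVelocity (planarCurve γ) t = dphi (chartCurve γ t) (velocity γ t) := by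
  rw [angularVelocity, logDeriv_apply, (hasDerivAt_planarCurve hd).deriv, dphi_eq_im_div]
  rfl

namespace IsLoopAt

variable {p : SymMat} {γ : ℝ → SymMat}

theorem continuousOn (h : IsLoopAt p γ) : ContinuousOn (chartCurve γ) (Icc 0 1) := by
  obtain ⟨n, s, hs, h0, h1, hd, -⟩ := h.piecewise_smooth
  rw [← h0, ← h1, ← biUnion_Icc_succ_eq_Icc hs (by simp [h0, h1]), biUnion_eq_iUnion]
  have : Finite (Ico 0 n) := (finite_Ico 0 n).to_subtype
  exact (locallyFinite_of_finite _).continuousOn_iUnion (fun i => isClosed_Icc)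
    fun i => (hd i i.2.2).continuousOn

theorem bounded_deriv_planarCurve (h : IsLoopAt p γ) :
    ∃ M, ∀ t ∈ Icc (0 : ℝ) 1, ‖deriv (planarCurve γ) t‖ ≤ M := by
  obtain ⟨n, s, hs, h0, h1, hd, -⟩ := h.piecewise_smooth
  rw [← h0, ← h1, ← biUnion_Icc_succ_eq_Icc hs (by simp [h0, h1])]
  obtain ⟨M, hM⟩ := ((Bornology.isBounded_biUnion (finite_Ico 0 n)).2 fun i hi =>
    isBounded_image_deriv_Icc (planar.contDiff.comp_contDiffOn
      ((hd i hi.2).of_le (by simp)))).exists_norm_le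
  refine ⟨M, fun t ht => hM _ ?_⟩
  rw [← image_iUnion₂]
  exact ⟨t, ht, rfl⟩

theorem exists_breakpoints (h : IsLoopAt p γ) : ∃ B : Set ℝ, B.Finite ∧
    (∀ t ∈ B, γ t ∉ L) ∧ ∀ t ∈ Ioo (0 : ℝ) 1 \ B, ContDiffAt ℝ ∞ (chartCurve γ) t := by
  obtain ⟨n, s, hs, h0, h1, hd, hL⟩ := h.piecewise_smooth
  refine ⟨s '' Iic n, (finite_Iic n).image s, forall_mem_image.2 hL, fun t ht => ?_⟩
  have hmem := Ioo_subset_Icc_self ht.1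
  rw [← h0, ← h1, ← biUnion_Icc_succ_eq_Icc hs (by simp [h0, h1])] at hmem
  obtain ⟨i, hi, hti⟩ := mem_iUnion₂.1 hmem
  have hne (j : ℕ) (hj : j ≤ n) : s j ≠ t := fun e => ht.2 ⟨j, hj, e⟩
  exact (hd i hi.2).contDiffAt
    (Icc_mem_nhds (hti.1.lt_of_ne (hne i hi.2.le)) (hti.2.lt_of_ne (hne (i + 1) hi.2).symm))

theorem contDiffAt_of_mem_L (h : IsLoopAt p γ) {t : ℝ} (ht : t ∈ Ioo (0 : ℝ) 1) (hL : γ t ∈ L) :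
    ContDiffAt ℝ ∞ (chartCurve γ) t := by
  obtain ⟨B, -, hBL, hB⟩ := h.exists_breakpoints
  exact hB t ⟨ht, fun htB => hBL t htB hL⟩

theorem countable_not_differentiableAt (h : IsLoopAt p γ) :
    {t ∈ Ioo (0 : ℝ) 1 | ¬DifferentiableAt ℝ (chartCurve γ) t}.Countable := by
  obtain ⟨B, hfin, -, hB⟩ := h.exists_breakpoints
  refine hfin.countable.mono fun t ⟨ht, hd⟩ => ?_
  by_contra htB
  exact hd ((hB t ⟨ht, htB⟩).differentiableAt (by simp))

theorem isTransverseCurve (h : IsLoopAt p γ) (hp : p ∉ L) :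
    IsTransverseCurve (planarCurve γ) 0 1 := by
  have hinterior (t : ℝ) (ht : t ∈ Icc (0 : ℝ) 1) (h0 : planarCurve γ t = 0) :
      t ∈ Ioo (0 : ℝ) 1 := by
    have hL : γ t ∈ L := mem_L_iff.2 h0
    rcases eq_endpoints_or_mem_Ioo_of_mem_Icc ht with rfl | rfl | htI
    · exact absurd (h.source ▸ hL) hp
    · exact absurd (h.target ▸ hL) hp
    · exact htI
  have hsmooth (t : ℝ) (ht : t ∈ Icc (0 : ℝ) 1) (h0 : planarCurve γ t = 0) :
      ContDiffAt ℝ ∞ (chartCurve γ) t :=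
    h.contDiffAt_of_mem_L (hinterior t ht h0) (mem_L_iff.2 h0)
  have hcountable : {t ∈ Ioo (0 : ℝ) 1 | ¬DifferentiableAt ℝ (planarCurve γ) t}.Countable :=
    h.countable_not_differentiableAt.mono fun t ht =>
      And.intro ht.1 fun hd => ht.2 (hasDerivAt_planarCurve hd).differentiableAt
  exact
    { continuousOn := planar.continuous.comp_continuousOn h.continuousOn
      countable_not_differentiableAt := hcountable
      bounded_deriv := h.bounded_deriv_planarCurve
      mem_Ioo := hinterior
      contDiffAt t ht h0 :=
        planar.contDiff.contDiffAt.comp t ((hsmooth t ht h0).of_le (by norm_cast))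
      deriv_ne_zero t ht h0 := by
        rw [(hasDerivAt_planarCurve ((hsmooth t ht h0).differentiableAt (by simp))).deriv, Ne,
          planar_eq_zero_iff, not_and_or]
        exact h.transverse t (hinterior t ht h0) (mem_L_iff.2 h0) }

theorem ae_angularVelocity_eq_dphi (h : IsLoopAt p γ) : ∀ᵐ t, t ∈ uIoc (0 : ℝ) 1 →
    angularVelocity (planarCurve γ) t = dphi (chartCurve γ t) (velocity γ t) := by
  filter_upwards [h.countable_not_differentiableAt.ae_notMem volume,
    (countable_singleton (1 : ℝ)).ae_notMem volume] with t hd h1 ht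
  rw [uIoc_of_le zero_le_one] at ht
  exact angularVelocity_planarCurve (not_not.1 fun hd' => hd ⟨⟨ht.1, ht.2.lt_of_ne h1⟩, hd'⟩)

theorem intervalIntegrable_dphi (h : IsLoopAt p γ) (hp : p ∉ L) :
    IntervalIntegrable (fun t => dphi (chartCurve γ t) (velocity γ t)) volume 0 1 :=
  ((h.isTransverseCurve hp).intervalIntegrable (by simp) (by simp)).congr_ae
    ((ae_restrict_iff' measurableSet_uIoc).2 h.ae_angularVelocity_eq_dphi)

theorem pi_mul_windingNumber (h : IsLoopAt p γ) : Real.pi * windingNumber γ = turning γ 1 := by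
  rw [windingNumber, ← intervalIntegral.integral_congr_ae h.ae_angularVelocity_eq_dphi, turning,
    sweptAngle]
  field_simp

theorem continuousOn_turning (h : IsLoopAt p γ) (hp : p ∉ L) :
    ContinuousOn (turning γ) (Icc 0 1) :=
  ((h.isTransverseCurve hp).continuousOn_sweptAngle zero_le_one).div_const 2

theorem hasDerivAt_turning (h : IsLoopAt p γ) (hp : p ∉ L) {t : ℝ} (ht : t ∈ Ioo (0 : ℝ) 1)
    (hL : γ t ∉ L) (hd : DifferentiableAt ℝ (chartCurve γ) t) :
    HasDerivAt (turning γ) (dphi (chartCurve γ t) (velocity γ t) / 2) t := by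
  rw [← angularVelocity_planarCurve hd]
  exact ((h.isTransverseCurve hp).hasDerivAt_sweptAngle ht (fun h0 => hL (mem_L_iff.2 h0))
    (hasDerivAt_planarCurve hd).differentiableAt).div_const 2

theorem eventually_notMem_L (h : IsLoopAt p γ) (hp : p ∉ L) {t : ℝ} (ht : t ∈ Ioo (0 : ℝ) 1) :
    ∀ᶠ u in 𝓝[≠] t, γ u ∉ L := by
  have hmem : Icc 0 1 \ {u ∈ Icc (0 : ℝ) 1 | planarCurve γ u = 0} ∈ 𝓝[≠] t :=
    nhdsNE_of_nhdsNE_sdiff_finite (nhdsWithin_le_nhds (Icc_mem_nhds ht.1 ht.2))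
      (h.isTransverseCurve hp).finite_zeros.to_subtype
  filter_upwards [hmem] with u hu hL
  exact hu.2 ⟨hu.1, mem_L_iff.1 hL⟩

theorem isParallelAlong (h : IsLoopAt p γ) (hp : p ∉ L) (a : Fin 3 → ℝ) :
    IsParallelAlong γ fun t => ofComponents (chartCurve γ t) (rotate (turning γ t) a) where
  continuous t ht hL :=
    (differentiableAt_ofComponents (notMem_L_iff.1 hL) _).continuousAt.comp_continuousWithinAt
      (f := fun u => (chartCurve γ u, rotate (turning γ u) a))
      ((h.continuousOn t ht).prodMk
        (tendsto_rotate (h.continuousOn_turning hp t ht) tendsto_const_nhds))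
  parallel t ht hL hd := by
    have hq : HasDerivAt (chartCurve γ) (velocity γ t) t := hd.hasDerivAt
    have hr : rSq (chartCurve γ t) ≠ 0 := notMem_L_iff.1 hL
    have hne : ∀ᶠ u in 𝓝 t, rSq (chartCurve γ u) ≠ 0 :=
      (continuous_rSq.continuousAt.comp hd.continuousAt).eventually_ne hr
    have hrotate := hasDerivAt_rotate (h.hasDerivAt_turning hp ht hL hd) (hasDerivAt_const t a)
    rw [zero_add, rotate_smul_rotationField] at hrotate
    refine (hasDerivAt_neg_christoffelForm_iff hr hq).2 ?_
    rw [frameComponents_ofComponents hr]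
    exact hrotate.congr_of_eventuallyEq (hne.mono fun u hu => frameComponents_ofComponents hu _)
  crossing t ht _ := by
    have hturning : ContinuousAt (turning γ) t :=
      (h.continuousOn_turning hp).continuousAt (Icc_mem_nhds ht.1 ht.2)
    refine ⟨_, (tendsto_rotate (hturning.tendsto.mono_left nhdsWithin_le_nhds)
      (tendsto_const_nhds (x := a))).congr' ?_⟩
    exact (h.eventually_notMem_L hp ht).mono fun u hu =>
      (frameComponents_ofComponents (notMem_L_iff.1 hu) _).symm

/-- Turning the components back by `turning γ` makes them locally constant off the axis. -/
theorem frameComponents_one (h : IsLoopAt p γ) (hp : p ∉ L) {E : ℝ → V}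
    (hE : IsParallelAlong γ E) : frameComponents (chart p) (E 1) =
      rotate (turning γ 1) (frameComponents (chart p) (E 0)) := by
  have hw := h.isTransverseCurve hp
  have hcomp (t : ℝ) (ht : t ∈ Icc (0 : ℝ) 1) (hL : γ t ∉ L) : ContinuousWithinAt
      (fun u => frameComponents (chartCurve γ u) (E u)) (Icc 0 1) t :=
    (differentiableAt_frameComponents (notMem_L_iff.1 hL) _).continuousAt.comp_continuousWithinAt
      (f := fun u => (chartCurve γ u, E u))
      ((h.continuousOn t ht).prodMk (hE.continuous t ht hL))
  have hconst := eq_of_hasDerivAt_zero_of_tendsto zero_le_one hw.finite_zeros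
    (fun t ht => hw.mem_Ioo t ht.1 ht.2) h.countable_not_differentiableAt
    (f := fun t => rotate (-turning γ t) (frameComponents (chartCurve γ t) (E t))) ?_ ?_ ?_
  · have hzero : turning γ 0 = 0 := by rw [turning, sweptAngle_self, zero_div]
    rw [hzero, neg_zero, rotate_zero, chartCurve, chartCurve, h.source, h.target] at hconst
    rw [← hconst, rotate_rotate, add_neg_cancel, rotate_zero]
  · intro t ⟨ht, h0⟩
    exact tendsto_rotate (h.continuousOn_turning hp t ht).neg
      (hcomp t ht fun hL => h0 ⟨ht, mem_L_iff.1 hL⟩)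
  · intro t ⟨ht, h0⟩
    have ht' := hw.mem_Ioo t ht h0
    obtain ⟨c, hc⟩ := hE.crossing t ht' (mem_L_iff.2 h0)
    have hturning : ContinuousAt (turning γ) t :=
      (h.continuousOn_turning hp).continuousAt (Icc_mem_nhds ht'.1 ht'.2)
    exact ⟨_, tendsto_rotate (hturning.neg.tendsto.mono_left nhdsWithin_le_nhds) hc⟩
  · intro t ⟨⟨ht, h0⟩, hd⟩
    have hL : γ t ∉ L := fun hL => h0 ⟨Ioo_subset_Icc_self ht, mem_L_iff.1 hL⟩
    replace hd : DifferentiableAt ℝ (chartCurve γ) t := not_not.1 fun hd' => hd ⟨ht, hd'⟩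
    have hq : HasDerivAt (chartCurve γ) (velocity γ t) t := hd.hasDerivAt
    have hderiv := hasDerivAt_rotate (h.hasDerivAt_turning hp ht hL hd).neg
      ((hasDerivAt_neg_christoffelForm_iff (notMem_L_iff.1 hL) hq).1 (hE.parallel t ht hL hd))
    rwa [neg_smul, add_neg_cancel, rotate_const_zero] at hderiv

theorem isParallelTransport_iff (h : IsLoopAt p γ) (hp : p ∉ L) (T : V →ₗ[ℝ] V) :
    IsParallelTransport γ T ↔ T = rotation p (Real.pi * windingNumber γ) := by
  have hr := notMem_L_iff.1 hp
  rw [h.pi_mul_windingNumber]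
  constructor
  · refine fun hT => LinearMap.ext fun v => ?_
    obtain ⟨E, hE, rfl, h1⟩ := hT v
    rw [← h1, rotation_apply, ← h.frameComponents_one hp hE, ofComponents_frameComponents hr]
  · rintro rfl v
    refine ⟨_, h.isParallelAlong hp (frameComponents (chart p) v), ?_, ?_⟩
    · rw [turning, sweptAngle_self, zero_div, rotate_zero, chartCurve, h.source,
        ofComponents_frameComponents hr]
    · rw [rotation_apply, chartCurve, h.target]

theorem planarCurve_one (h : IsLoopAt p γ) : planarCurve γ 1 = planarCurve γ 0 := by
  rw [planarCurve, planarCurve, chartCurve, chartCurve, h.source, h.target]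

theorem exists_turning_eq_int_mul_half_pi (h : IsLoopAt p γ) (hp : p ∉ L) :
    ∃ k : ℤ, turning γ 1 = k * (Real.pi / 2) := by
  obtain ⟨k, hk⟩ :=
    (h.isTransverseCurve hp).exists_sweptAngle_eq_int_mul_pi zero_le_one h.planarCurve_one
  exact ⟨k, by rw [turning, hk, mul_div_assoc]⟩

theorem exists_turning_eq_int_mul_pi (h : IsLoopAt p γ) (hp : p ∉ L)
    (hL : ∀ t ∈ Icc (0 : ℝ) 1, γ t ∈ Lᶜ) : ∃ k : ℤ, turning γ 1 = k * Real.pi := by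
  obtain ⟨k, hk⟩ := (h.isTransverseCurve hp).exists_sweptAngle_eq_int_mul_two_pi zero_le_one
    h.planarCurve_one fun t ht h0 => hL t ht (mem_L_iff.2 h0)
  exact ⟨k, by rw [turning, hk]; ring⟩

end IsLoopAt

/-- The curve at the height `z` over the plane curve `w`. -/
def lift (z : ℝ) (w : ℝ → ℂ) (t : ℝ) : SymMat := chart.symm ![(w t).re, (w t).im, z]

theorem chartCurve_lift (z : ℝ) (w : ℝ → ℂ) (t : ℝ) :
    chartCurve (lift z w) t = ![(w t).re, (w t).im, z] :=
  chart.apply_symm_apply _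

theorem planarCurve_lift (z : ℝ) (w : ℝ → ℂ) : planarCurve (lift z w) = w := by
  ext t
  rw [planarCurve, chartCurve_lift, planar_apply]
  rfl

theorem lift_eq {p : SymMat} {w : ℝ → ℂ} {t : ℝ} (h : w t = planar (chart p)) :
    lift (chart p 2) w t = p := by
  rw [lift, Equiv.symm_apply_eq, h, planar_apply]
  ext i
  fin_cases i <;> rfl

theorem contDiff_chartCurve_lift {w : ℝ → ℂ} (hw : ContDiff ℝ ∞ w) (z : ℝ) :
    ContDiff ℝ ∞ (chartCurve (lift z w)) := by
  rw [funext (chartCurve_lift z w)]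
  refine contDiff_pi.2 fun i => ?_
  fin_cases i
  · exact Complex.reCLM.contDiff.comp hw
  · exact Complex.imCLM.contDiff.comp hw
  · exact contDiff_const

theorem isLoopAt_lift {p : SymMat} (hp : p ∉ L) {w : ℝ → ℂ} (hw : ContDiff ℝ ∞ w)
    (h0 : w 0 = planar (chart p)) (h1 : w 1 = planar (chart p))
    (htransverse : ∀ t, w t = 0 → deriv w t ≠ 0) : IsLoopAt p (lift (chart p 2) w) where
  source := lift_eq h0
  target := lift_eq h1
  piecewise_smooth := by
    refine ⟨1, fun i => i, Nat.mono_cast, Nat.cast_zero, Nat.cast_one,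
      fun i _ => (contDiff_chartCurve_lift hw _).contDiffOn, fun i hi => ?_⟩
    interval_cases i
    · simpa only [Nat.cast_zero, lift_eq h0] using hp
    · simpa only [Nat.cast_one, lift_eq h1] using hp
  transverse t _ hL := by
    have hderiv := (hasDerivAt_planarCurve
      ((contDiff_chartCurve_lift hw (chart p 2)).differentiable (by simp) t)).deriv
    have hzero : planarCurve (lift (chart p 2) w) t = 0 := mem_L_iff.1 hL
    rw [planarCurve_lift] at hderiv hzero
    rw [← not_and_or, ← planar_eq_zero_iff, ← hderiv]
    exact htransverse t hzero

theorem exists_isLoopAt_of_spiral {p : SymMat} (hp : p ∉ L) {α : ℝ} {ρ : ℝ → ℝ}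
    (hρ : ContDiff ℝ ∞ ρ) (h0 : ρ 0 = 1) (h1 : ρ 1 * Complex.exp (α * Complex.I) = 1)
    (htransverse : ∀ t, ρ t = 0 → deriv ρ t ≠ 0) :
    ∃ γ, IsLoopAt p γ ∧ (∀ t, γ t ∈ L → ρ t = 0) ∧ turning γ 1 = α / 2 := by
  set c := planar (chart p)
  have hc : c ≠ 0 := fun h => hp (mem_L_iff.2 h)
  have hd : Differentiable ℝ ρ := hρ.differentiable (by simp)
  have hzero (t : ℝ) (ht : spiral c α ρ t = 0) : ρ t = 0 := by
    simpa [spiral, hc, Complex.exp_ne_zero] using ht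
  have hloop : IsLoopAt p (lift (chart p 2) (spiral c α ρ)) := by
    refine isLoopAt_lift hp ?_ (by simp [spiral, h0, c]) ?_ fun t ht => ?_
    · unfold spiral
      exact (contDiff_const.mul (Complex.ofRealCLM.contDiff.comp hρ)).mul
        ((contDiff_const.mul Complex.ofRealCLM.contDiff).mul contDiff_const).cexp
    · rw [spiral, Complex.ofReal_one, mul_one, mul_assoc, h1, mul_one]
    · rw [(hasDerivAt_spiral (hd t).hasDerivAt).deriv, hzero t ht]
      simp [hc, htransverse t (hzero t ht)]
  refine ⟨_, hloop, fun t hL => hzero t ?_, ?_⟩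
  · rw [← planarCurve_lift (chart p 2) (spiral c α ρ)]
    exact mem_L_iff.1 hL
  · have hfinite := (hloop.isTransverseCurve hp).finite_zeros
    rw [planarCurve_lift] at hfinite
    rw [turning, planarCurve_lift, sweptAngle_spiral hc hd, sub_zero, one_mul]
    filter_upwards [hfinite.countable.ae_notMem volume] with t ht htI h
    rw [uIoc_of_le zero_le_one] at htI
    exact ht ⟨Ioc_subset_Icc_self htI, by simp [spiral, h]⟩

theorem exists_isLoopAt_turning_eq_int_mul_pi {p : SymMat} (hp : p ∉ L) (k : ℤ) :
    ∃ γ, IsLoopAt p γ ∧ (∀ t, γ t ∉ L) ∧ turning γ 1 = k * Real.pi := by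
  obtain ⟨γ, hγ, hL, hturn⟩ := exists_isLoopAt_of_spiral hp (α := k * (2 * Real.pi))
    (ρ := fun _ => 1) contDiff_const rfl
    (by simpa [mul_assoc] using Complex.exp_int_mul_two_pi_mul_I k) (by simp)
  exact ⟨γ, hγ, fun t ht => one_ne_zero (hL t ht), by rw [hturn]; ring⟩

/-- The curve `cos (k π t) exp (i k π t)` in the plane runs `k` times around a circle through the
origin. -/
theorem exists_isLoopAt_turning_eq_int_mul_half_pi {p : SymMat} (hp : p ∉ L) (k : ℤ) :
    ∃ γ, IsLoopAt p γ ∧ turning γ 1 = k * (Real.pi / 2) := by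
  have hderiv (t : ℝ) : HasDerivAt (fun t : ℝ => Real.cos (k * Real.pi * t))
      (-Real.sin (k * Real.pi * t) * (k * Real.pi)) t := by
    simpa using ((hasDerivAt_id t).const_mul (k * Real.pi)).cos
  have hclosed : Real.cos (k * Real.pi * 1) * Complex.exp ((k * Real.pi : ℝ) * Complex.I) = 1 := by
    rw [mul_one, Complex.exp_mul_I, ← Complex.ofReal_cos, ← Complex.ofReal_sin,
      Real.sin_int_mul_pi, Complex.ofReal_zero, zero_mul, add_zero, ← Complex.ofReal_mul, ← sq,
      Real.cos_sq', Real.sin_int_mul_pi]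
    simp
  have htransverse (t : ℝ) (ht : Real.cos (k * Real.pi * t) = 0) :
      deriv (fun t : ℝ => Real.cos (k * Real.pi * t)) t ≠ 0 := by
    have hk : (k : ℝ) ≠ 0 := fun hk => by simp [hk] at ht
    have hsin : Real.sin (k * Real.pi * t) ≠ 0 := fun hs => by
      simpa [ht, hs] using Real.sin_sq_add_cos_sq (k * Real.pi * t)
    rw [(hderiv t).deriv]
    exact mul_ne_zero (neg_ne_zero.2 hsin) (mul_ne_zero hk Real.pi_ne_zero)
  obtain ⟨γ, hγ, -, hturn⟩ :=
    exists_isLoopAt_of_spiral hp (by fun_prop) (by simp) hclosed htransverse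
  exact ⟨γ, hγ, by rw [hturn, mul_div_assoc]⟩

end Loops

section Holonomy

variable {p : SymMat}

theorem rotation_comp_rotation (hp : p ∉ L) (θ η : ℝ) :
    rotation p θ ∘ₗ rotation p η = rotation p (θ + η) := by
  refine LinearMap.ext fun v => ?_
  rw [LinearMap.comp_apply, rotation_apply, rotation_apply,
    frameComponents_ofComponents (notMem_L_iff.1 hp), rotate_rotate, ← rotation_apply]

theorem rotation_zero (hp : p ∉ L) : rotation p 0 = LinearMap.id := by
  refine LinearMap.ext fun v => ?_
  rw [rotation_apply, rotate_zero, ofComponents_frameComponents (notMem_L_iff.1 hp),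
    LinearMap.id_apply]

theorem rotation_eq_id_iff (hp : p ∉ L) {θ : ℝ} :
    rotation p θ = LinearMap.id ↔ ∃ k : ℤ, k * (2 * Real.pi) = θ := by
  have hr := notMem_L_iff.1 hp
  rw [← Real.cos_eq_one_iff]
  constructor
  · intro h
    have hrotate := congrArg (frameComponents (chart p))
      (LinearMap.congr_fun h (ofComponents (chart p) (Pi.single 0 1)))
    rw [rotation_apply, LinearMap.id_apply, frameComponents_ofComponents hr,
      frameComponents_ofComponents hr] at hrotate
    simpa [rotate] using congrFun hrotate 0
  · intro hcos
    have hsin : Real.sin θ = 0 := by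
      simpa [hcos] using Real.sin_sq_add_cos_sq θ
    rw [← rotation_zero hp]
    refine LinearMap.ext fun v => ?_
    rw [rotation_apply, rotation_apply, rotate, rotate, hcos, hsin, Real.cos_zero, Real.sin_zero]

/-- The rotations of the tangent space at `p`, as a one-parameter group. -/
def rotationHom (hp : p ∉ L) : Multiplicative ℝ →* (V ≃ₗ[ℝ] V) where
  toFun θ := LinearEquiv.ofLinearMap (rotation p θ.toAdd) (rotation p (-θ.toAdd))
    (by rw [rotation_comp_rotation hp, add_neg_cancel, rotation_zero hp])
    (by rw [rotation_comp_rotation hp, neg_add_cancel, rotation_zero hp])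
  map_one' := LinearEquiv.toLinearMap_injective (rotation_zero hp)
  map_mul' θ η :=
    LinearEquiv.toLinearMap_injective (rotation_comp_rotation hp θ.toAdd η.toAdd).symm

theorem coe_rotationHom (hp : p ∉ L) (θ : ℝ) :
    (rotationHom hp (.ofAdd θ) : V →ₗ[ℝ] V) = rotation p θ := rfl

theorem mem_zpowers_rotationHom_iff (hp : p ∉ L) {α : ℝ} {T : V ≃ₗ[ℝ] V} :
    T ∈ Subgroup.zpowers (rotationHom hp (.ofAdd α)) ↔
      ∃ k : ℤ, (T : V →ₗ[ℝ] V) = rotation p (k * α) := by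
  refine Subgroup.mem_zpowers_iff.trans (exists_congr fun k => ?_)
  rw [← map_zpow, ← ofAdd_zsmul, zsmul_eq_mul, ← coe_rotationHom hp, LinearEquiv.toLinearMap_inj,
    eq_comm]

theorem orderOf_rotationHom (hp : p ∉ L) {α : ℝ} {n : ℕ}
    (hα : n * α = 2 * Real.pi) : orderOf (rotationHom hp (.ofAdd α)) = n := by
  refine Nat.dvd_right_iff_eq.1 fun m => ?_
  rw [orderOf_dvd_iff_pow_eq_one, ← map_pow, ← ofAdd_nsmul, nsmul_eq_mul,
    ← LinearEquiv.toLinearMap_inj, coe_rotationHom]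
  refine (rotation_eq_id_iff hp).trans ?_
  have hα0 : α ≠ 0 := fun h => by simp [h, Real.pi_ne_zero] at hα
  rw [← Int.natCast_dvd_natCast, dvd_iff_exists_eq_mul_right]
  refine exists_congr fun k => ?_
  rw [← hα, ← mul_assoc, mul_left_inj' hα0, eq_comm, mul_comm]
  norm_cast

theorem holonomyGroup_of_loopTransports (hp : p ∉ L) {U : Set SymMat} {α : ℝ} {n : ℕ}
    (hα : n * α = 2 * Real.pi)
    (hT : loopTransports U p = Subgroup.zpowers (rotationHom hp (.ofAdd α))) :
    (holonomyGroup U p : Set (V ≃ₗ[ℝ] V)) = loopTransports U p ∧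
      (∀ T : V ≃ₗ[ℝ] V, T ∈ holonomyGroup U p ↔
        ∃ k : ℤ, (T : V →ₗ[ℝ] V) = rotation p (k * α)) ∧
      Nonempty (holonomyGroup U p ≃* Multiplicative (ZMod n)) := by
  have hzpowers : holonomyGroup U p = Subgroup.zpowers (rotationHom hp (.ofAdd α)) := by
    rw [holonomyGroup, hT, Subgroup.closure_eq]
  rw [hzpowers, ← orderOf_rotationHom hp hα, ← Nat.card_zpowers]
  exact ⟨hT.symm, fun T => mem_zpowers_rotationHom_iff hp,
    ⟨(zmodCyclicMulEquiv inferInstance).symm⟩⟩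

theorem mem_loopTransports_iff (hp : p ∉ L) {U : Set SymMat} {T : V ≃ₗ[ℝ] V} :
    T ∈ loopTransports U p ↔ ∃ γ, IsLoopAt p γ ∧ (∀ t ∈ Icc (0 : ℝ) 1, γ t ∈ U) ∧
      (T : V →ₗ[ℝ] V) = rotation p (turning γ 1) := by
  refine exists_congr fun γ => and_congr_right fun h => and_congr_right fun _ => ?_
  rw [h.isParallelTransport_iff hp, h.pi_mul_windingNumber]

theorem loopTransports_compl_L (hp : p ∉ L) :
    loopTransports Lᶜ p = Subgroup.zpowers (rotationHom hp (.ofAdd Real.pi)) := by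
  ext T
  rw [mem_loopTransports_iff hp, SetLike.mem_coe, mem_zpowers_rotationHom_iff]
  constructor
  · rintro ⟨γ, h, hL, hT⟩
    obtain ⟨k, hk⟩ := h.exists_turning_eq_int_mul_pi hp hL
    exact ⟨k, hk ▸ hT⟩
  · rintro ⟨k, hT⟩
    obtain ⟨γ, h, hL, hk⟩ := exists_isLoopAt_turning_eq_int_mul_pi hp k
    exact ⟨γ, h, fun t _ => hL t, hk ▸ hT⟩

theorem loopTransports_univ (hp : p ∉ L) :
    loopTransports univ p = Subgroup.zpowers (rotationHom hp (.ofAdd (Real.pi / 2))) := by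
  ext T
  rw [mem_loopTransports_iff hp, SetLike.mem_coe, mem_zpowers_rotationHom_iff]
  constructor
  · rintro ⟨γ, h, -, hT⟩
    obtain ⟨k, hk⟩ := h.exists_turning_eq_int_mul_half_pi hp
    exact ⟨k, hk ▸ hT⟩
  · rintro ⟨k, hT⟩
    obtain ⟨γ, h, hk⟩ := exists_isLoopAt_turning_eq_int_mul_half_pi hp k
    exact ⟨γ, h, fun _ _ => mem_univ _, hk ▸ hT⟩

end Holonomy

end SymHol

end

theorem mainTheorem6 (p : SymHol.SymMat) (hp : p ∉ SymHol.L) :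
    -- the holonomy of a loop is the rotation by `π` times its winding number around `L`
    (∀ γ : ℝ → SymHol.SymMat, SymHol.IsLoopAt p γ →
      IntervalIntegrable (fun t => SymHol.dphi (SymHol.chartCurve γ t) (SymHol.velocity γ t))
        MeasureTheory.volume 0 1 ∧
      ∀ T : SymHol.V →ₗ[ℝ] SymHol.V, SymHol.IsParallelTransport γ T ↔
        T = SymHol.rotation p (Real.pi * SymHol.windingNumber γ)) ∧
    -- the holonomy group of `Sym(2,ℝ) ∖ L`
    ((SymHol.holonomyGroup SymHol.Lᶜ p : Set (SymHol.V ≃ₗ[ℝ] SymHol.V)) =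
        SymHol.loopTransports SymHol.Lᶜ p ∧
      (∀ T : SymHol.V ≃ₗ[ℝ] SymHol.V, T ∈ SymHol.holonomyGroup SymHol.Lᶜ p ↔
        ∃ k : ℤ, (T : SymHol.V →ₗ[ℝ] SymHol.V) = SymHol.rotation p (k * Real.pi)) ∧
      Nonempty (SymHol.holonomyGroup SymHol.Lᶜ p ≃* Multiplicative (ZMod 2))) ∧
    -- the holonomy group of `Sym(2,ℝ)`
    ((SymHol.holonomyGroup Set.univ p : Set (SymHol.V ≃ₗ[ℝ] SymHol.V)) =
        SymHol.loopTransports Set.univ p ∧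
      (∀ T : SymHol.V ≃ₗ[ℝ] SymHol.V, T ∈ SymHol.holonomyGroup Set.univ p ↔
        ∃ k : ℤ, (T : SymHol.V →ₗ[ℝ] SymHol.V) = SymHol.rotation p (k * (Real.pi / 2))) ∧
      Nonempty (SymHol.holonomyGroup Set.univ p ≃* Multiplicative (ZMod 4))) := by
  refine ⟨fun γ h => ⟨h.intervalIntegrable_dphi hp, h.isParallelTransport_iff hp⟩, ?_, ?_⟩
  · have htwo : ((2 : ℕ) : ℝ) * Real.pi = 2 * Real.pi := by norm_num
    exact SymHol.holonomyGroup_of_loopTransports hp htwo (SymHol.loopTransports_compl_L hp)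
  · have hfour : ((4 : ℕ) : ℝ) * (Real.pi / 2) = 2 * Real.pi := by push_cast; ring
    exact SymHol.holonomyGroup_of_loopTransports hp hfour (SymHol.loopTransports_univ hp)
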